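/- Let $n\ge 0$, let $R$ be a commutative ring with unit containing $\mathbb{Q}$, and let $G=(G_1,\dots,G_n)$ be power series in $R[[u_1,\dots,u_n]]$. There is a unique system $F=(F_1,\dots,F_n)$ of power series in $R[[X_1,\dots,X_n]]$ without constant term such that $F_i=X_i\,G_i(F)$ for $1\le i\le n$. For multiindices $\alpha,\beta\in\mathbb{N}^n$, define the formal Gaussian integral with identity covariance of a monomial by $$\int d\overline u\,du\ e^{-\overline u u}\ \overline u^{\alpha}u^{\beta}=\sum_{\sigma}\ \prod_{k=1}^{|\alpha|}\delta_{\tau'(\sigma(k)),\,\tau(k)}\in R,$$ where $\tau:\{1,\dots,|\alpha|\}\to\{1,\dots,n\}$ and $\tau':\{1,\dots,|\beta|\}\to\{1,\dots,n\}$ are any maps taking each value $i$ exactly $\alpha_i$, respectively $\beta_i$, times, and $\sigma$ runs over all bijections $\{1,\dots,|\alpha|\}\to\{1,\dots,|\beta|\}$. For $U=\sum_{\alpha,\beta}U_{\alpha\beta}(X)\,\overline u^{\alpha}u^{\beta}\in R[[\overline u,u,X]]$ put $$\int d\overline u\,du\ e^{-\overline u u}\ U=\sum_{\alpha,\beta}U_{\alpha\beta}(X)\int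 d\overline u\,du\ e^{-\overline u u}\ \overline u^{\alpha}u^{\beta}$$ whenever this family is summable in $R[[X]]$ (for coefficientwise convergence, $R$ being discrete). Let $\overline u XG(u)=\sum_{i=1}^n\overline u_iX_iG_i(u)$, and let $X\partial G(F)$ be the $n\times n$ matrix over $R[[X]]$ with entries $X_i\,\frac{\partial G_i}{\partial u_j}(F)$. Then the formal integral $$Z=\int d\overline u\,du\ e^{-\overline u u}\ e^{\overline u XG(u)}$$ is well defined, that is, the family defining it is summable in $R[[X]]$; the determinant $\det(I-X\partial G(F))$ is invertible in $R[[X]]$; and $$Z=\frac{1}{\det\bigl(I-X\partial G(F)\bigr)}.$$ -/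

import Mathlib

namespace LagrangeGood

noncomputable section

/-- The variables of the big power series ring: `ū₁,…,ūₙ`, `u₁,…,uₙ`, `X₁,…,Xₙ`, in this order. -/
abbrev Var (n : ℕ) : Type := Fin n ⊕ Fin n ⊕ Fin n

/-- The ring `R[[ū, u, X]]`. -/
abbrev BigRing (n : ℕ) (R : Type*) : Type _ := MvPowerSeries (Var n) R

variable {n : ℕ} {R : Type*} [CommRing R]

/-- The indeterminate `ūᵢ`. -/
def ubar (i : Fin n) : BigRing n R := MvPowerSeries.X (Sum.inl i)

/-- The indeterminate `uᵢ`. -/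
def uvar (i : Fin n) : BigRing n R := MvPowerSeries.X (Sum.inr (Sum.inl i))

/-- The indeterminate `Xᵢ` in the big ring. -/
def xvar (i : Fin n) : BigRing n R := MvPowerSeries.X (Sum.inr (Sum.inr i))

/-- The formal Gaussian integral `∫ dū du e^{-ūAu} ū^α u^β ∈ R` of a monomial, with covariance
`A⁻¹`: the sum over all bijections (Wick contractions) between the `|α|` factors of `ū^α` and the
`|β|` factors of `u^β` of the product of the covariances, times `(det A)⁻¹`. The factors of `ū^α`
are indexed by `Σ i, Fin (α i)`, the factor `⟨i, r⟩` being the `r`-th copy of `ūᵢ`. -/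
def gaussMonomial (A : GL (Fin n) R) (α β : Fin n →₀ ℕ) : R :=
  (↑(Matrix.GeneralLinearGroup.det A)⁻¹ : R) *
    ∑ σ : (Σ i, Fin (α i)) ≃ (Σ i, Fin (β i)),
      ∏ k : Σ i, Fin (α i), (↑A⁻¹ : Matrix (Fin n) (Fin n) R) (σ k).1 k.1

/-- The coefficient of `ū^α u^β` in `U ∈ R[[ū, u, X]]`, as an element of `R[[X]]`. -/
def coeffX (U : BigRing n R) (α β : Fin n →₀ ℕ) : MvPowerSeries (Fin n) R :=
  fun γ => MvPowerSeries.coeff (α.sumElim (β.sumElim γ)) U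

/-- The term of index `(α, β)` in the family whose sum is the formal Gaussian integral of `U`. -/
def gaussTerm (A : GL (Fin n) R) (U : BigRing n R) (p : (Fin n →₀ ℕ) × (Fin n →₀ ℕ)) :
    MvPowerSeries (Fin n) R :=
  MvPowerSeries.C (gaussMonomial A p.1 p.2) * coeffX U p.1 p.2

open scoped MvPowerSeries.WithPiTopology in
/-- `U` is formally integrable: the family defining its formal Gaussian integral is summable in
`R[[X]]`, for the usual topology (that of coefficientwise convergence, `R` being discrete). -/
def GaussIntegrable (A : GL (Fin n) R) (U : BigRing n R) : Prop :=
  letI : TopologicalSpace R := ⊥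
  Summable (gaussTerm A U)

open scoped MvPowerSeries.WithPiTopology in
/-- The formal Gaussian integral `∫ dū du e^{-ūAu} U ∈ R[[X]]` of `U ∈ R[[ū, u, X]]`
(meaningful if `GaussIntegrable A U`). -/
def gaussIntegral (A : GL (Fin n) R) (U : BigRing n R) : MvPowerSeries (Fin n) R :=
  letI : TopologicalSpace R := ⊥
  ∑' p, gaussTerm A U p

/-- The element `ū X G(u) = ∑ᵢ ūᵢ Xᵢ Gᵢ(u)` of `R[[ū, u, X]]`. -/
def action (G : Fin n → MvPowerSeries (Fin n) R) : BigRing n R :=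
  ∑ i, ubar i * xvar i * MvPowerSeries.subst (uvar : Fin n → BigRing n R) (G i)

/-- The element `exp (ū X G(u))` of `R[[ū, u, X]]`. -/
def expAction [Algebra ℚ R] (G : Fin n → MvPowerSeries (Fin n) R) : BigRing n R :=
  (PowerSeries.exp R).subst (action G)

/-- The partition function `Z = ∫ dū du e^{-ūu} e^{ūXG(u)}`. -/
def partitionFunction [Algebra ℚ R] (G : Fin n → MvPowerSeries (Fin n) R) :
    MvPowerSeries (Fin n) R :=
  gaussIntegral 1 (expAction G)

/-- `F` is a system of power series without constant term with `Fᵢ = Xᵢ Gᵢ(F)` for all `i`. -/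
def IsImplicitSolution (G F : Fin n → MvPowerSeries (Fin n) R) : Prop :=
  (∀ i, MvPowerSeries.constantCoeff (F i) = 0) ∧
    ∀ i, F i = MvPowerSeries.X i * MvPowerSeries.subst F (G i)

/-- The matrix `X∂G(F)`, with entries `Xᵢ (∂ⱼGᵢ)(F)`. -/
def xJacobian (G F : Fin n → MvPowerSeries (Fin n) R) :
    Matrix (Fin n) (Fin n) (MvPowerSeries (Fin n) R) :=
  Matrix.of fun i j =>
    MvPowerSeries.X i * MvPowerSeries.subst F (MvPowerSeries.pderiv R j (G i))

end

end LagrangeGood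

namespace LagrangeGood

open MvPowerSeries

/-! ### Congruences modulo total degree `k` -/

section Truncation

variable {σ R : Type*} [Finite σ] [CommRing R]

/-! Expanding the exponential, only pairs `α = β` survive the Gaussian pairing. There the `∏ αᵢ!`
contractions cancel the exponential's denominators, so `Z = ∑_γ X^γ [u^γ] G^γ`. This is `D(1)`,
where `D(H) = ∑_γ X^γ [u^γ] (H G^γ)` is `diagonalSeries`.

Shifting `γ` gives `D(Xᵢ H) = Xᵢ D(Gᵢ H)`, the same recursion that defines `F`. Since multiplication
by `Xᵢ` gains one degree, induction on the truncation order gives `D(H) = H(F) D(1)`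
(`IsImplicitSolution.diagonalSeries_eq`).

By this identity, the `γ`-coefficient of `det(1 - X∂G(F)) D(1)` is `[u^γ]` of a determinant in the
powers of `G`. For `γ ≠ 0`, up to row and column scalings, that is `det(γᵢ δᵢⱼ Eᵢ - uⱼ ∂ⱼ Eᵢ)` with
`Eᵢ = Gᵢ^γᵢ`. Euler operators act diagonally on monomials, so each choice of exponents `lᵢ` with `∑
lᵢ = γ` contributes a multiple of `det(γᵢ δᵢⱼ - lᵢⱼ)`, whose columns sum to zero. Hence only the
constant term `1` remains. -/

theorem truncTotal_eq_iff {k : ℕ} {f g : MvPowerSeries σ R} :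
    truncTotal k f = truncTotal k g ↔ ∀ d, d.degree < k → coeff d f = coeff d g := by
  refine ⟨fun h d hd => ?_, fun h => MvPolynomial.ext _ _ fun d => ?_⟩
  · rw [← coeff_truncTotal f hd, h, coeff_truncTotal g hd]
  · by_cases hd : d.degree < k
    · rw [coeff_truncTotal f hd, coeff_truncTotal g hd, h d hd]
    · rw [coeff_truncTotal_eq_zero f (not_lt.mp hd), coeff_truncTotal_eq_zero g (not_lt.mp hd)]

theorem ext_truncTotal {f g : MvPowerSeries σ R} (h : ∀ k, truncTotal k f = truncTotal k g) :
    f = g :=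
  MvPowerSeries.ext fun d => truncTotal_eq_iff.mp (h (d.degree + 1)) d (Nat.lt_succ_self _)

theorem truncTotal_mono {k m : ℕ} (hkm : k ≤ m) {f g : MvPowerSeries σ R}
    (h : truncTotal m f = truncTotal m g) : truncTotal k f = truncTotal k g :=
  truncTotal_eq_iff.mpr fun d hd => truncTotal_eq_iff.mp h d (hd.trans_le hkm)

theorem truncTotal_toMvPowerSeries_self (k : ℕ) (f : MvPowerSeries σ R) :
    truncTotal k (truncTotal k f : MvPowerSeries σ R) = truncTotal k f :=
  truncTotal_eq_iff.mpr fun d hd => by rw [MvPolynomial.coeff_coe, coeff_truncTotal f hd]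

theorem truncTotal_mul_congr {k : ℕ} {f g : MvPowerSeries σ R} (h : MvPowerSeries σ R)
    (hfg : truncTotal k f = truncTotal k g) : truncTotal k (h * f) = truncTotal k (h * g) := by
  classical
  refine truncTotal_eq_iff.mpr fun d hd => ?_
  rw [coeff_mul, coeff_mul]
  refine Finset.sum_congr rfl fun p hp => ?_
  rw [truncTotal_eq_iff.mp hfg p.2]
  have : p.1.degree + p.2.degree = d.degree := by
    rw [← Finset.HasAntidiagonal.mem_antidiagonal.mp hp, map_add]
  omega

theorem truncTotal_X_mul_congr {k : ℕ} {f g : MvPowerSeries σ R} (i : σ)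
    (hfg : truncTotal k f = truncTotal k g) :
    truncTotal (k + 1) (X i * f) = truncTotal (k + 1) (X i * g) := by
  refine truncTotal_eq_iff.mpr fun d hd => ?_
  rw [X_def, coeff_monomial_mul, coeff_monomial_mul]
  split_ifs with h
  · rw [truncTotal_eq_iff.mp hfg]
    have : (d - Finsupp.single i 1).degree + (Finsupp.single i 1).degree = d.degree := by
      rw [← map_add, tsub_add_cancel_of_le h]
    rw [Finsupp.degree_single] at this
    omega
  · rfl

theorem truncTotal_subst_congr {τ : Type*} [Finite τ] {k : ℕ} {a b : τ → MvPowerSeries σ R}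
    (ha : ∀ i, constantCoeff (a i) = 0) (hb : ∀ i, constantCoeff (b i) = 0)
    (hab : ∀ i, truncTotal k (a i) = truncTotal k (b i)) (f : MvPowerSeries τ R) :
    truncTotal k (f.subst a) = truncTotal k (f.subst b) := by
  rw [truncTotal_subst ha, truncTotal_subst hb]
  simp only [hab]

end Truncation

/-! ### Existence and uniqueness of `F` by contraction -/

section ImplicitSolution

variable {n : ℕ} {R : Type*} [CommRing R] (G : Fin n → MvPowerSeries (Fin n) R)

/-- The successive approximations of the solution of `Fᵢ = Xᵢ Gᵢ(F)`. -/
noncomputable def approxSolution : ℕ → Fin n → MvPowerSeries (Fin n) R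
  | 0 => 0
  | k + 1 => fun i => X i * (G i).subst (approxSolution k)

theorem constantCoeff_approxSolution (k : ℕ) (i : Fin n) :
    constantCoeff (approxSolution G k i) = 0 := by
  cases k <;> simp [approxSolution]

theorem truncTotal_approxSolution_succ (k : ℕ) (i : Fin n) :
    truncTotal k (approxSolution G (k + 1) i) = truncTotal k (approxSolution G k i) := by
  induction k generalizing i with
  | zero => exact truncTotal_eq_iff.mpr fun d hd => absurd hd (Nat.not_lt_zero _)
  | succ k ih =>
    exact truncTotal_X_mul_congr i (truncTotal_subst_congr (constantCoeff_approxSolution G _)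
      (constantCoeff_approxSolution G _) ih _)

theorem truncTotal_approxSolution_of_le {k m : ℕ} (h : k ≤ m) (i : Fin n) :
    truncTotal k (approxSolution G m i) = truncTotal k (approxSolution G k i) := by
  induction m, h using Nat.le_induction with
  | base => rfl
  | succ m hm ih =>
    exact (truncTotal_mono hm (truncTotal_approxSolution_succ G m i)).trans ih

/-- The limit of the successive approximations. -/
noncomputable def implicitSolution (i : Fin n) : MvPowerSeries (Fin n) R :=
  fun d => coeff d (approxSolution G (d.degree + 1) i)

theorem coeff_implicitSolution (i : Fin n) (d : Fin n →₀ ℕ) :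
    coeff d (implicitSolution G i) = coeff d (approxSolution G (d.degree + 1) i) :=
  coeff_apply _ d

theorem truncTotal_implicitSolution (k : ℕ) (i : Fin n) :
    truncTotal k (implicitSolution G i) = truncTotal k (approxSolution G k i) := by
  refine truncTotal_eq_iff.mpr fun d hd => ?_
  have h := truncTotal_approxSolution_of_le G (k := d.degree + 1) hd i
  rw [coeff_implicitSolution, truncTotal_eq_iff.mp h d (Nat.lt_succ_self _)]

theorem constantCoeff_implicitSolution (i : Fin n) : constantCoeff (implicitSolution G i) = 0 := by
  rw [← coeff_zero_eq_constantCoeff_apply, coeff_implicitSolution,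
    coeff_zero_eq_constantCoeff_apply, constantCoeff_approxSolution]

theorem isImplicitSolution_implicitSolution : IsImplicitSolution G (implicitSolution G) := by
  -- Comparing modulo degree `k + 1` lets the left side be the iterate `k + 1`, which is by
  -- definition `Xᵢ Gᵢ` of the iterate `k`.
  refine ⟨constantCoeff_implicitSolution G,
    fun i => ext_truncTotal fun k => truncTotal_mono k.le_succ ?_⟩
  rw [truncTotal_implicitSolution G (k + 1)]
  exact truncTotal_X_mul_congr i (truncTotal_subst_congr (constantCoeff_approxSolution G _)
    (constantCoeff_implicitSolution G) (fun j => (truncTotal_implicitSolution G k j).symm) _)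

variable {G}

theorem IsImplicitSolution.unique {F F' : Fin n → MvPowerSeries (Fin n) R}
    (hF : IsImplicitSolution G F) (hF' : IsImplicitSolution G F') : F = F' := by
  refine funext fun i => ext_truncTotal fun k => ?_
  induction k generalizing i with
  | zero => exact truncTotal_eq_iff.mpr fun d hd => absurd hd (Nat.not_lt_zero _)
  | succ k ih =>
    rw [hF.2 i, hF'.2 i]
    exact truncTotal_X_mul_congr i (truncTotal_subst_congr hF.1 hF'.1 ih _)

theorem IsImplicitSolution.hasSubst {F : Fin n → MvPowerSeries (Fin n) R}
    (hF : IsImplicitSolution G F) : HasSubst F :=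
  hasSubst_of_constantCoeff_zero hF.1

end ImplicitSolution

/-! ### The diagonal operator and its multiplicativity -/

section DiagonalSeries

variable {n : ℕ} {R : Type*} [CommRing R] (G : Fin n → MvPowerSeries (Fin n) R)

/-- The series `∑_γ X^γ [u^γ] (H G^γ)`. -/
noncomputable def diagonalSeries : MvPowerSeries (Fin n) R →ₗ[R] MvPowerSeries (Fin n) R where
  toFun H := fun γ => coeff γ (H * ∏ i, G i ^ γ i)
  map_add' H K := by
    funext γ
    simp only [add_mul, map_add]
    rfl
  map_smul' r H := by
    funext γ
    simp only [smul_mul_assoc, map_smul]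
    rfl

theorem coeff_diagonalSeries (H : MvPowerSeries (Fin n) R) (γ : Fin n →₀ ℕ) :
    coeff γ (diagonalSeries G H) = coeff γ (H * ∏ i, G i ^ γ i) :=
  rfl

theorem diagonalSeries_X_mul (i : Fin n) (H : MvPowerSeries (Fin n) R) :
    diagonalSeries G (X i * H) = X i * diagonalSeries G (G i * H) := by
  ext γ
  rw [coeff_diagonalSeries, X_def, mul_assoc, coeff_monomial_mul, coeff_monomial_mul]
  split_ifs with h
  · obtain ⟨δ, rfl⟩ := exists_add_of_le h
    rw [add_tsub_cancel_left, coeff_diagonalSeries]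
    congr 2
    have : ∏ j, G j ^ (Finsupp.single i 1 + δ : Fin n →₀ ℕ) j = G i * ∏ j, G j ^ δ j := by
      simp only [Finsupp.add_apply, pow_add, Finset.prod_mul_distrib]
      congr 1
      rw [Finset.prod_eq_single i] <;> simp +contextual [eq_comm]
    rw [this]
    ring
  · rfl

theorem truncTotal_diagonalSeries_congr {k : ℕ} {K L : MvPowerSeries (Fin n) R}
    (h : truncTotal k K = truncTotal k L) (H : MvPowerSeries (Fin n) R) :
    truncTotal k (diagonalSeries G (K * H)) = truncTotal k (diagonalSeries G (L * H)) := by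
  refine truncTotal_eq_iff.mpr fun d hd => ?_
  rw [coeff_diagonalSeries, coeff_diagonalSeries, mul_assoc, mul_assoc, mul_comm K, mul_comm L]
  exact truncTotal_eq_iff.mp (truncTotal_mul_congr _ h) d hd

variable {G} {F : Fin n → MvPowerSeries (Fin n) R}

/-- Multiplication by a variable generates multiplication by any polynomial, and modulo degree `k` a
series `K` matters only through its truncation. -/
theorem IsImplicitSolution.truncTotal_diagonalSeries_of_X (hF : IsImplicitSolution G F) {k : ℕ}
    (h : ∀ i H, truncTotal k (diagonalSeries G (X i * H)) =
      truncTotal k (F i * diagonalSeries G H)) (K H : MvPowerSeries (Fin n) R) :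
    truncTotal k (diagonalSeries G (K * H)) =
      truncTotal k (K.subst F * diagonalSeries G H) := by
  have key (p : MvPolynomial (Fin n) R) (H : MvPowerSeries (Fin n) R) :
      truncTotal k (diagonalSeries G ((p : MvPowerSeries (Fin n) R) * H)) =
        truncTotal k ((p : MvPowerSeries (Fin n) R).subst F * diagonalSeries G H) := by
    induction p using MvPolynomial.induction_on generalizing H with
    | C r =>
      rw [MvPolynomial.coe_C, subst_C, ← MvPowerSeries.smul_eq_C_mul,
        ← MvPowerSeries.smul_eq_C_mul, map_smul]
    | add p q hp hq =>
      rw [MvPolynomial.coe_add, subst_add hF.hasSubst, add_mul, add_mul, map_add, map_add, map_add,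
        hp, hq]
    | mul_X p i hp =>
      rw [MvPolynomial.coe_mul, MvPolynomial.coe_X, mul_assoc, hp, subst_mul hF.hasSubst,
        subst_X hF.hasSubst, mul_assoc]
      exact truncTotal_mul_congr _ (h i H)
  rw [truncTotal_diagonalSeries_congr G (truncTotal_toMvPowerSeries_self k K).symm, key,
    mul_comm, mul_comm (K.subst F)]
  exact truncTotal_mul_congr _ (truncTotal_subst_eq_truncTotal_truncTotal_subst hF.1).symm

theorem IsImplicitSolution.diagonalSeries_eq (hF : IsImplicitSolution G F)
    (H : MvPowerSeries (Fin n) R) :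
    diagonalSeries G H = H.subst F * diagonalSeries G 1 := by
  have key (k : ℕ) (i : Fin n) (H : MvPowerSeries (Fin n) R) :
      truncTotal k (diagonalSeries G (X i * H)) = truncTotal k (F i * diagonalSeries G H) := by
    induction k generalizing i H with
    | zero => exact truncTotal_eq_iff.mpr fun d hd => absurd hd (Nat.not_lt_zero _)
    | succ k ih =>
      -- Both sides become `Xᵢ` times series that agree modulo degree `k`, by the induction
      -- hypothesis extended from variables to `Gᵢ`.
      conv_rhs => rw [hF.2 i, mul_assoc]
      rw [diagonalSeries_X_mul]
      exact truncTotal_X_mul_congr i (hF.truncTotal_diagonalSeries_of_X ih _ _)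
  refine ext_truncTotal fun k => ?_
  conv_lhs => rw [← mul_one H]
  exact hF.truncTotal_diagonalSeries_of_X (key k) H 1

end DiagonalSeries

/-! ### The determinant identity -/

section Determinant

variable {n : ℕ} {R : Type*} [CommRing R]

theorem monomial_one_mul_cancel {σ : Type*} {e : σ →₀ ℕ} {f g : MvPowerSeries σ R}
    (h : monomial e 1 * f = monomial e 1 * g) : f = g := by
  ext d
  simpa only [coeff_add_monomial_mul, one_mul] using congrArg (coeff (e + d)) h

theorem coeff_X_mul_pderiv {σ : Type*} (i : σ) (f : MvPowerSeries σ R) (d : σ →₀ ℕ) :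
    coeff d (X i * pderiv R i f) = d i * coeff d f := by
  rw [X_def, coeff_monomial_mul]
  split_ifs with h
  · obtain ⟨e, rfl⟩ := exists_add_of_le h
    rw [add_tsub_cancel_left, coeff_pderiv, add_comm e]
    simp [add_comm, mul_comm]
  · have : d i = 0 := by simpa using h
    simp [this]

theorem prod_X_eq_monomial (t : Finset (Fin n)) :
    ∏ i ∈ t, (X i : MvPowerSeries (Fin n) R) =
      monomial (∑ i ∈ t, Finsupp.single i 1) 1 := by
  simp [X_def, MvPowerSeries.prod_monomial]

/-- Expand over the set `t` of factors contributing `Xᵢ bᵢ`: pulling `X^t` out of the coefficient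
lowers the exponent of `Gᵢ` by one for `i ∈ t`. Terms where `t` meets `γᵢ = 0` vanish on both sides.
-/
theorem IsImplicitSolution.coeff_prod_mul_diagonalSeries {G F : Fin n → MvPowerSeries (Fin n) R}
    (hF : IsImplicitSolution G F) (a b : Fin n → MvPowerSeries (Fin n) R) (γ : Fin n →₀ ℕ) :
    coeff γ ((∏ i, ((a i).subst F - X i * (b i).subst F)) * diagonalSeries G 1) =
      coeff γ (∏ i, (a i * G i ^ γ i -
        if γ i = 0 then 0 else X i * (b i * G i ^ (γ i - 1)))) := by
  rw [Finset.prod_sub, Finset.prod_sub, Finset.sum_mul, map_sum, map_sum]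
  refine Finset.sum_congr rfl fun t _ => ?_
  have hsign (f : MvPowerSeries (Fin n) R) :
      coeff γ ((-1) ^ t.card * f) = (-1) ^ t.card * coeff γ f := by
    rcases Nat.even_or_odd t.card with h | h <;> simp [h.neg_one_pow]
  have hl : (-1) ^ t.card * (∏ i ∈ Finset.univ \ t, (a i).subst F) *
        (∏ i ∈ t, X i * (b i).subst F) * diagonalSeries G 1 =
      (-1) ^ t.card * (monomial (∑ i ∈ t, Finsupp.single i 1) 1 *
        diagonalSeries G ((∏ i ∈ Finset.univ \ t, a i) * ∏ i ∈ t, b i)) := by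
    rw [hF.diagonalSeries_eq (_ * _), ← coe_substAlgHom hF.hasSubst, map_mul, map_prod, map_prod,
      Finset.prod_mul_distrib, prod_X_eq_monomial]
    ring
  rw [hl, mul_assoc, hsign, hsign]
  congr 1
  by_cases ht : ∀ i ∈ t, γ i ≠ 0
  · have hle : ∑ i ∈ t, Finsupp.single i 1 ≤ γ := by
      intro j
      simp only [Finsupp.finsetSum_apply, Finsupp.single_apply, Finset.sum_ite_eq']
      split_ifs with h
      · exact Nat.one_le_iff_ne_zero.mpr (ht j h)
      · exact Nat.zero_le _
    have hr : (∏ i ∈ Finset.univ \ t, a i * G i ^ γ i) *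
          (∏ i ∈ t, if γ i = 0 then 0 else X i * (b i * G i ^ (γ i - 1))) =
        monomial (∑ i ∈ t, Finsupp.single i 1) 1 *
          ((∏ i ∈ Finset.univ \ t, a i) * (∏ i ∈ t, b i) *
            ∏ i, G i ^ (γ - ∑ i ∈ t, Finsupp.single i 1 : Fin n →₀ ℕ) i) := by
      rw [← Finset.prod_sdiff (Finset.subset_univ t) (f := fun i => G i ^ (_ : Fin n →₀ ℕ) i)]
      have h1 : ∏ i ∈ Finset.univ \ t,
            G i ^ (γ - ∑ i ∈ t, Finsupp.single i 1 : Fin n →₀ ℕ) i =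
          ∏ i ∈ Finset.univ \ t, G i ^ γ i := by
        refine Finset.prod_congr rfl fun i hi => ?_
        have : i ∉ t := (Finset.mem_sdiff.mp hi).2
        simp [Finsupp.single_apply, this]
      have h2 : ∏ i ∈ t, G i ^ (γ - ∑ i ∈ t, Finsupp.single i 1 : Fin n →₀ ℕ) i =
          ∏ i ∈ t, G i ^ (γ i - 1) := by
        refine Finset.prod_congr rfl fun i hi => ?_
        simp [Finsupp.single_apply, hi]
      have h3 : (∏ i ∈ t, if γ i = 0 then 0 else X i * (b i * G i ^ (γ i - 1))) =
          ∏ i ∈ t, X i * (b i * G i ^ (γ i - 1)) :=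
        Finset.prod_congr rfl fun i hi => if_neg (ht i hi)
      rw [h1, h2, h3, Finset.prod_mul_distrib, Finset.prod_mul_distrib, Finset.prod_mul_distrib,
        prod_X_eq_monomial]
      ring
    rw [hr, coeff_monomial_mul, coeff_monomial_mul, if_pos hle, if_pos hle, coeff_diagonalSeries]
  · push Not at ht
    obtain ⟨i, hi, hγ⟩ := ht
    have hle : ¬ ∑ i ∈ t, Finsupp.single i 1 ≤ γ := fun h => by
      have := h i
      simp [Finsupp.finsetSum_apply, Finsupp.single_apply, hi, hγ] at this
    have hzero : (∏ i ∈ t, if γ i = 0 then 0 else X i * (b i * G i ^ (γ i - 1))) = 0 :=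
      Finset.prod_eq_zero hi (if_pos hγ)
    rw [coeff_monomial_mul, if_neg hle, hzero, mul_zero, map_zero]

theorem IsImplicitSolution.coeff_det_mul_diagonalSeries {G F : Fin n → MvPowerSeries (Fin n) R}
    (hF : IsImplicitSolution G F) (γ : Fin n →₀ ℕ) :
    coeff γ ((1 - xJacobian G F).det * diagonalSeries G 1) =
      coeff γ (Matrix.of fun i j => (1 : Matrix (Fin n) (Fin n) (MvPowerSeries (Fin n) R)) i j *
        G i ^ γ i - if γ i = 0 then 0 else
          X i * (pderiv R j (G i) * G i ^ (γ i - 1))).det := by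
  rw [← Matrix.det_transpose, ← Matrix.det_transpose (Matrix.of _), Matrix.det_apply,
    Matrix.det_apply, Finset.sum_mul, map_sum, map_sum]
  refine Finset.sum_congr rfl fun π _ => ?_
  rw [smul_mul_assoc, Units.smul_def, Units.smul_def, map_zsmul, map_zsmul]
  congr 1
  have h := hF.coeff_prod_mul_diagonalSeries
    (fun i => (1 : Matrix (Fin n) (Fin n) (MvPowerSeries (Fin n) R)) i (π i))
    (fun i => pderiv R (π i) (G i)) γ
  refine Eq.trans ?_ h
  congr 2
  refine Finset.prod_congr rfl fun i _ => ?_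
  have h1 : ((1 : Matrix (Fin n) (Fin n) (MvPowerSeries (Fin n) R)) i (π i)).subst F =
      (1 : Matrix (Fin n) (Fin n) (MvPowerSeries (Fin n) R)) i (π i) := by
    rw [← coe_substAlgHom hF.hasSubst, Matrix.one_apply]
    split_ifs
    · exact map_one _
    · exact map_zero _
  rw [h1]
  rfl

/-- The vector which is `1` on the support of `γ` is in the left kernel of the matrix. -/
theorem det_diagonal_sub_eq_zero {γ : Fin n →₀ ℕ} (hγ : γ ≠ 0) (l : Fin n → Fin n →₀ ℕ)
    (hl : ∑ i, l i = γ) (hl0 : ∀ i, γ i = 0 → l i = 0) :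
    (Matrix.of fun i j => (if i = j then ((if γ i = 0 then 1 else γ i : ℕ) : ℤ) else 0) -
      (l i j : ℤ)).det = 0 := by
  refine Matrix.exists_vecMul_eq_zero_iff.mp ⟨fun i => if γ i = 0 then 0 else 1, ?_, ?_⟩
  · obtain ⟨i, hi⟩ := Finsupp.ne_iff.mp hγ
    intro h
    simpa [show γ i ≠ 0 from hi] using congrFun h i
  · funext j
    have hj : ∑ i, (l i j : ℤ) = γ j := by
      rw [← hl]
      simp [Finsupp.finsetSum_apply]
    have hterm (i : Fin n) : (if γ i = 0 then (0 : ℤ) else 1) *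
        ((if i = j then ((if γ i = 0 then 1 else γ i : ℕ) : ℤ) else 0) - (l i j : ℤ)) =
        (if i = j then (γ i : ℤ) else 0) - (l i j : ℤ) := by
      by_cases h : γ i = 0
      · simp [h, hl0 i h]
      · simp [h]
    simp only [Matrix.vecMul, dotProduct, Matrix.of_apply, hterm, Finset.sum_sub_distrib, hj]
    simp

theorem coeff_det_euler_eq_zero {γ : Fin n →₀ ℕ} (hγ : γ ≠ 0)
    (E : Fin n → MvPowerSeries (Fin n) R) (hE : ∀ i, γ i = 0 → E i = 1) :
    coeff γ (Matrix.of fun i j => (if i = j then ((if γ i = 0 then 1 else γ i : ℕ) :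
      MvPowerSeries (Fin n) R) else 0) * E i - X j * pderiv R j (E i)).det = 0 := by
  have hcoeff (i j : Fin n) (d : Fin n →₀ ℕ) :
      coeff d ((if i = j then ((if γ i = 0 then 1 else γ i : ℕ) :
        MvPowerSeries (Fin n) R) else 0) * E i - X j * pderiv R j (E i)) =
      (((if i = j then ((if γ i = 0 then 1 else γ i : ℕ) : ℤ) else 0) - (d j : ℤ) : ℤ) : R) *
        coeff d (E i) := by
    rw [map_sub, coeff_X_mul_pderiv]
    split_ifs <;> simp [sub_mul, ← nsmul_eq_mul]
  rw [← Matrix.det_transpose, Matrix.det_apply, map_sum]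
  simp only [Units.smul_def, map_zsmul, Matrix.transpose_apply, Matrix.of_apply,
    MvPowerSeries.coeff_prod, hcoeff, Finset.prod_mul_distrib, Finset.smul_sum]
  rw [Finset.sum_comm]
  refine Finset.sum_eq_zero fun l hl => ?_
  simp only [← smul_mul_assoc]
  rw [← Finset.sum_mul]
  by_cases hl0 : ∀ i, γ i = 0 → l i = 0
  -- The vanishing is proved over `ℤ`, where a nonzero kernel vector forces a zero determinant, and
  -- then cast to `R`, which need not be a domain.
  · have h := congrArg (Int.cast : ℤ → R) (det_diagonal_sub_eq_zero hγ l
      (Finset.mem_finsuppAntidiag.mp hl).1 hl0)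
    rw [← Matrix.det_transpose, Matrix.det_apply] at h
    simp only [Units.smul_def, Matrix.transpose_apply, Matrix.of_apply] at h
    convert zero_mul _ using 2
    refine Eq.trans ?_ (h.trans Int.cast_zero)
    push_cast
    simp
  · push Not at hl0
    obtain ⟨i, hi, hli⟩ := hl0
    rw [Finset.prod_eq_zero (Finset.mem_univ i), mul_zero]
    rw [hE i hi, coeff_one, if_neg hli]

theorem coeff_det_pow_eq_zero [Algebra ℚ R] (G : Fin n → MvPowerSeries (Fin n) R)
    {γ : Fin n →₀ ℕ} (hγ : γ ≠ 0) :
    coeff γ (Matrix.of fun i j => (1 : Matrix (Fin n) (Fin n) (MvPowerSeries (Fin n) R)) i j *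
      G i ^ γ i - if γ i = 0 then 0 else X i * (pderiv R j (G i) * G i ^ (γ i - 1))).det = 0 := by
  set N : Matrix (Fin n) (Fin n) (MvPowerSeries (Fin n) R) := Matrix.of fun i j =>
    (1 : Matrix (Fin n) (Fin n) (MvPowerSeries (Fin n) R)) i j *
      G i ^ γ i - if γ i = 0 then 0 else X i * (pderiv R j (G i) * G i ^ (γ i - 1)) with hN
  -- The value `1` where `γᵢ = 0` keeps every weight invertible in `R`; the corresponding row is
  -- already that of the identity.
  let w (i : Fin n) : ℕ := if γ i = 0 then 1 else γ i
  let M : Matrix (Fin n) (Fin n) (MvPowerSeries (Fin n) R) := Matrix.of fun i j =>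
    (if i = j then (w i : MvPowerSeries (Fin n) R) else 0) * G i ^ γ i -
      X j * pderiv R j (G i ^ γ i)
  have hM : coeff γ M.det = 0 :=
    coeff_det_euler_eq_zero hγ (fun i => G i ^ γ i) fun i hi => by rw [hi, pow_zero]
  have hscale (i j : Fin n) : (X j : MvPowerSeries (Fin n) R) * ((w i : MvPowerSeries (Fin n) R) * N i j) =
      X i * M i j := by
    simp only [hN, M, w, Matrix.of_apply, pderiv_pow, Matrix.one_apply]
    by_cases hi : γ i = 0
    · by_cases hij : i = j
      · subst hij
        simp [hi]
      · simp [hi, hij]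
    · by_cases hij : i = j
      · subst hij
        simp only [hi, if_true, if_false]
        ring
      · simp only [hi, hij, if_false]
        ring
  -- Scaling columns on one side and rows on the other by the variables produces the same factor `∏
  -- Xᵢ`, which is cancellable.
  have hdet : M.det = (∏ i, (w i : MvPowerSeries (Fin n) R)) * N.det := by
    refine (monomial_one_mul_cancel (e := ∑ i, Finsupp.single i 1) ?_).symm
    rw [← prod_X_eq_monomial, ← Matrix.det_mul_column (fun i => (w i : MvPowerSeries (Fin n) R)),
      ← Matrix.det_mul_row, ← Matrix.det_mul_column]
    congr 1
    ext1 i j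
    exact hscale i j
  rw [hdet, ← Nat.cast_prod, ← nsmul_eq_mul, map_nsmul, nsmul_eq_mul] at hM
  have hw : IsUnit ((∏ i, w i : ℕ) : R) := by
    have h0 : ((∏ i, w i : ℕ) : ℚ) ≠ 0 := by
      refine Nat.cast_ne_zero.mpr (Finset.prod_ne_zero_iff.mpr fun i _ => ?_)
      simp only [w]
      split_ifs with h <;> simp [h]
    simpa using (isUnit_iff_ne_zero.mpr h0).map (algebraMap ℚ R)
  exact (hw.mul_right_eq_zero).mp hM

theorem IsImplicitSolution.det_mul_diagonalSeries [Algebra ℚ R]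
    {G F : Fin n → MvPowerSeries (Fin n) R} (hF : IsImplicitSolution G F) :
    (1 - xJacobian G F).det * diagonalSeries G 1 = 1 := by
  ext γ
  rw [hF.coeff_det_mul_diagonalSeries, coeff_one]
  split_ifs with hγ
  · subst hγ
    have : (Matrix.of fun i j => (1 : Matrix (Fin n) (Fin n) (MvPowerSeries (Fin n) R)) i j *
        G i ^ (0 : Fin n →₀ ℕ) i - if (0 : Fin n →₀ ℕ) i = 0 then 0 else
          X i * (pderiv R j (G i) * G i ^ ((0 : Fin n →₀ ℕ) i - 1))) = 1 := by
      ext1 i j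
      simp
    rw [this, Matrix.det_one, coeff_zero_one]
  · exact coeff_det_pow_eq_zero G hγ

end Determinant

/-! ### Wick contractions with identity covariance -/

section Gaussian

open scoped Nat

variable {n : ℕ} {R : Type*} [CommRing R]

/-- The nonzero contractions are the permutations preserving the index `i`, that is, the stabilizer
of `Sigma.fst`. -/
theorem gaussMonomial_one_self (α : Fin n →₀ ℕ) :
    gaussMonomial (1 : GL (Fin n) R) α α = ((∏ i, (α i)! : ℕ) : R) := by
  have hterm (σ : (Σ i, Fin (α i)) ≃ (Σ i, Fin (α i))) :
      ∏ k : Σ i, Fin (α i), (1 : Matrix (Fin n) (Fin n) R) (σ k).1 k.1 =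
        if Sigma.fst ∘ σ = Sigma.fst then 1 else 0 := by
    simp only [Matrix.one_apply, Finset.prod_ite_zero, Finset.prod_const_one, Finset.mem_univ,
      true_imp_iff, funext_iff, Function.comp_apply]
  have hcard (i : Fin n) : Fintype.card {a : Σ i, Fin (α i) // a.1 = i} = α i := by
    rw [Fintype.card_congr (Equiv.sigmaSubtype i), Fintype.card_fin]
  have h := DomMulAct.stabilizer_card (Sigma.fst : (Σ i, Fin (α i)) → Fin n)
  simp only [hcard] at h
  simp only [gaussMonomial, inv_one, map_one, Units.val_one, one_mul, hterm, Finset.sum_boole]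
  rw [← h, Fintype.card_subtype]

theorem gaussMonomial_one_of_ne {α β : Fin n →₀ ℕ} (h : α ≠ β) :
    gaussMonomial (1 : GL (Fin n) R) α β = 0 := by
  simp only [gaussMonomial, inv_one, map_one, Units.val_one, one_mul]
  refine Finset.sum_eq_zero fun σ _ => ?_
  by_contra hσ
  have hfst (k : Σ i, Fin (α i)) : (σ k).1 = k.1 := by
    by_contra hk
    exact hσ (Finset.prod_eq_zero (Finset.mem_univ k) (Matrix.one_apply_ne hk))
  refine h (Finsupp.ext fun i => ?_)
  have e : {a : Σ i, Fin (α i) // a.1 = i} ≃ {a : Σ i, Fin (β i) // a.1 = i} :=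
    σ.subtypeEquiv fun a => by rw [hfst]
  simpa using Fintype.card_congr
    (((Equiv.sigmaSubtype i).symm.trans e).trans (Equiv.sigmaSubtype i))

end Gaussian

/-! ### Coefficients of the exponential and evaluation of `Z` -/

section Exponential

open scoped Nat

variable {n : ℕ} {R : Type*} [CommRing R]

/-- The inclusion of the variables `uᵢ` into all variables. -/
def uEmbedding (n : ℕ) : Fin n ↪ Var n :=
  Function.Embedding.inl.trans Function.Embedding.inr

theorem subst_uvar (g : MvPowerSeries (Fin n) R) :
    g.subst (uvar : Fin n → BigRing n R) = rename (uEmbedding n) g :=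
  (rename_eq_subst (uEmbedding n) g).symm

theorem embDomain_uEmbedding (β : Fin n →₀ ℕ) :
    β.embDomain (uEmbedding n) = (0 : Fin n →₀ ℕ).sumElim (β.sumElim 0) := by
  rw [uEmbedding, Finsupp.embDomain_trans_apply, Finsupp.embDomain_inl, Finsupp.embDomain_inr]

theorem sumElim_sumElim_mem_range_mapDomain {α β γ : Fin n →₀ ℕ}
    (h : α.sumElim (β.sumElim γ) ∈ Set.range (Finsupp.mapDomain (uEmbedding n))) :
    α = 0 ∧ γ = 0 := by
  obtain ⟨δ, hδ⟩ := h
  rw [← Finsupp.embDomain_eq_mapDomain, embDomain_uEmbedding] at hδ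
  refine ⟨Finsupp.ext fun i => ?_, Finsupp.ext fun i => ?_⟩
  · exact (DFunLike.congr_fun hδ (Sum.inl i)).symm
  · exact (DFunLike.congr_fun hδ (Sum.inr (Sum.inr i))).symm

theorem coeff_monomial_mul_rename (κ α β γ : Fin n →₀ ℕ) (g : MvPowerSeries (Fin n) R) :
    coeff (α.sumElim (β.sumElim γ))
      (monomial (κ.sumElim ((0 : Fin n →₀ ℕ).sumElim κ)) 1 * rename (uEmbedding n) g) =
      if κ = α ∧ κ = γ then coeff β g else 0 := by
  rw [coeff_monomial_mul]
  by_cases h : κ = α ∧ κ = γ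
  · obtain ⟨rfl, rfl⟩ := h
    have hsub : κ.sumElim (β.sumElim κ) - κ.sumElim ((0 : Fin n →₀ ℕ).sumElim κ) =
        β.embDomain (uEmbedding n) := by
      rw [embDomain_uEmbedding]
      ext (i | i | i) <;> simp
    rw [if_pos, if_pos ⟨rfl, rfl⟩, hsub, coeff_embDomain_rename, one_mul]
    rintro (i | i | i) <;> simp
  · rw [if_neg h]
    split_ifs with hle
    · rw [one_mul, coeff_rename_eq_zero]
      intro hmem
      have hsub : α.sumElim (β.sumElim γ) - κ.sumElim ((0 : Fin n →₀ ℕ).sumElim κ) =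
          (α - κ).sumElim (β.sumElim (γ - κ)) := by
        ext (i | i | i) <;> simp
      rw [hsub] at hmem
      obtain ⟨hα, hγ⟩ := sumElim_sumElim_mem_range_mapDomain hmem
      refine h ⟨le_antisymm (fun i => ?_) (tsub_eq_zero_iff_le.mp hα),
        le_antisymm (fun i => ?_) (tsub_eq_zero_iff_le.mp hγ)⟩
      · simpa using hle (Sum.inl i)
      · simpa using hle (Sum.inr (Sum.inr i))
    · rfl

theorem prod_action_term_pow (G : Fin n → MvPowerSeries (Fin n) R) (κ : Fin n →₀ ℕ) :
    ∏ i, (ubar i * xvar i * (G i).subst (uvar : Fin n → BigRing n R)) ^ κ i =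
      monomial (κ.sumElim ((0 : Fin n →₀ ℕ).sumElim κ)) 1 *
        rename (uEmbedding n) (∏ i, G i ^ κ i) := by
  simp only [mul_pow, Finset.prod_mul_distrib, subst_uvar, map_prod, map_pow]
  congr 1
  rw [monomial_one_eq, Finsupp.prod_fintype _ _ (fun _ => pow_zero _), Fintype.prod_sum_type,
    Fintype.prod_sum_type]
  simp [ubar, xvar]

theorem coeff_action_pow (G : Fin n → MvPowerSeries (Fin n) R) (m : ℕ) (α β γ : Fin n →₀ ℕ) :
    coeff (α.sumElim (β.sumElim γ)) (action G ^ m) =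
      if α.degree = m ∧ α = γ then
        (Nat.multinomial Finset.univ α : R) * coeff β (∏ i, G i ^ α i) else 0 := by
  rw [action, Finset.sum_pow_eq_sum_piAntidiag, map_sum]
  have hterm (k : Fin n → ℕ) : coeff (α.sumElim (β.sumElim γ))
      ((Nat.multinomial Finset.univ k : BigRing n R) *
        ∏ i, (ubar i * xvar i * (G i).subst (uvar : Fin n → BigRing n R)) ^ k i) =
      if k = α ∧ α = γ then (Nat.multinomial Finset.univ α : R) * coeff β (∏ i, G i ^ α i)
        else 0 := by
    have h := prod_action_term_pow G (Finsupp.equivFunOnFinite.symm k)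
    simp only [Finsupp.equivFunOnFinite_symm_apply_apply] at h
    rw [h, ← nsmul_eq_mul, map_nsmul, nsmul_eq_mul, coeff_monomial_mul_rename]
    by_cases hk : k = α
    · subst hk
      simp
    · have : Finsupp.equivFunOnFinite.symm k ≠ α := fun h => hk (by simp [← h])
      simp [hk, this]
  simp only [hterm]
  by_cases hγ : α = γ
  · simp only [hγ, and_true, Finset.sum_ite_eq', Finset.mem_piAntidiag]
    simp [Finsupp.degree_eq_sum]
  · simp [hγ]

theorem constantCoeff_action (G : Fin n → MvPowerSeries (Fin n) R) :
    constantCoeff (action G) = 0 := by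
  simp [action, ubar]

variable [Algebra ℚ R]

/-- Only the power `m = |α|` contributes, with coefficient `1/m!` times the multinomial of `α`,
which is `1/∏ αᵢ!`. Keeping the factorials on the left matches the Gaussian weight. -/
theorem prod_factorial_mul_coeff_expAction (G : Fin n → MvPowerSeries (Fin n) R)
    (α β γ : Fin n →₀ ℕ) :
    ((∏ i, (α i)! : ℕ) : R) * coeff (α.sumElim (β.sumElim γ)) (expAction G) =
      if α = γ then coeff β (∏ i, G i ^ α i) else 0 := by
  rw [expAction, PowerSeries.coeff_subst
    (PowerSeries.HasSubst.of_constantCoeff_zero (constantCoeff_action G)),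
    finsum_eq_single _ α.degree]
  · rw [coeff_action_pow]
    by_cases h : α = γ
    · simp only [h, and_self, if_true]
      rw [PowerSeries.coeff_exp, smul_eq_mul, ← mul_assoc, ← mul_assoc]
      convert one_mul _
      have hfac : (∏ i, (γ i)!) * Nat.multinomial Finset.univ γ = γ.degree ! := by
        rw [Nat.multinomial_spec, Finsupp.degree_eq_sum]
      rw [mul_right_comm, ← Nat.cast_mul, hfac, ← map_natCast (algebraMap ℚ R), ← map_mul,
        mul_one_div_cancel (Nat.cast_ne_zero.mpr (Nat.factorial_ne_zero _)), map_one]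
    · simp [h]
  · intro m hm
    rw [coeff_action_pow, if_neg (fun h => hm h.1.symm), smul_zero]

theorem coeff_gaussTerm_expAction (G : Fin n → MvPowerSeries (Fin n) R)
    (p : (Fin n →₀ ℕ) × (Fin n →₀ ℕ)) (γ : Fin n →₀ ℕ) :
    coeff γ (gaussTerm 1 (expAction G) p) =
      if p = (γ, γ) then coeff γ (∏ i, G i ^ γ i) else 0 := by
  obtain ⟨α, β⟩ := p
  have hcoeff : coeff γ (coeffX (expAction G) α β) =
      coeff (α.sumElim (β.sumElim γ)) (expAction G) := coeff_apply _ γ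
  rw [gaussTerm, coeff_C_mul, hcoeff]
  by_cases h : α = β
  · subst h
    rw [gaussMonomial_one_self, prod_factorial_mul_coeff_expAction]
    by_cases hγ : α = γ
    · simp [hγ]
    · simp [hγ]
  · rw [gaussMonomial_one_of_ne h, zero_mul, if_neg]
    rintro ⟨⟩
    exact h rfl

open scoped MvPowerSeries.WithPiTopology in
theorem hasSum_gaussTerm_expAction [TopologicalSpace R] (G : Fin n → MvPowerSeries (Fin n) R) :
    HasSum (gaussTerm 1 (expAction G)) (diagonalSeries G 1) := by
  rw [WithPiTopology.hasSum_iff_hasSum_coeff]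
  intro γ
  simp only [coeff_gaussTerm_expAction, coeff_diagonalSeries, one_mul]
  exact hasSum_ite_eq (γ, γ) _

open scoped MvPowerSeries.WithPiTopology in
theorem gaussIntegrable_expAction (G : Fin n → MvPowerSeries (Fin n) R) :
    GaussIntegrable 1 (expAction G) :=
  let : TopologicalSpace R := ⊥
  (hasSum_gaussTerm_expAction G).summable

open scoped MvPowerSeries.WithPiTopology in
theorem partitionFunction_eq_diagonalSeries (G : Fin n → MvPowerSeries (Fin n) R) :
    partitionFunction G = diagonalSeries G 1 := by
  let : TopologicalSpace R := ⊥
  have : DiscreteTopology R := ⟨rfl⟩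
  have : T2Space (MvPowerSeries (Fin n) R) := WithPiTopology.instT2Space
  exact (hasSum_gaussTerm_expAction G).tsum_eq

end Exponential

end LagrangeGood

theorem theorem7 (n : ℕ) (R : Type*) [CommRing R] [Algebra ℚ R]
    (G : Fin n → MvPowerSeries (Fin n) R) :
    (∃! F : Fin n → MvPowerSeries (Fin n) R, LagrangeGood.IsImplicitSolution G F) ∧
    LagrangeGood.GaussIntegrable 1 (LagrangeGood.expAction G) ∧
    ∀ F : Fin n → MvPowerSeries (Fin n) R, LagrangeGood.IsImplicitSolution G F →
      IsUnit (1 - LagrangeGood.xJacobian G F).det ∧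
      LagrangeGood.partitionFunction G =
        Ring.inverse (1 - LagrangeGood.xJacobian G F).det := by
  refine ⟨⟨LagrangeGood.implicitSolution G, LagrangeGood.isImplicitSolution_implicitSolution G,
    fun F hF => hF.unique (LagrangeGood.isImplicitSolution_implicitSolution G)⟩,
    LagrangeGood.gaussIntegrable_expAction G, fun F hF => ?_⟩
  have hmul := hF.det_mul_diagonalSeries
  have hunit : IsUnit (1 - LagrangeGood.xJacobian G F).det := IsUnit.of_mul_eq_one _ hmul
  refine ⟨hunit, hunit.mul_left_cancel ?_⟩
  rw [LagrangeGood.partitionFunction_eq_diagonalSeries, hmul, Ring.mul_inverse_cancel _ hunit]
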